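/- Regular spaces are assumed to be $T_1$. Let $Y$ be a regular space, and let $Z$ be a regular space that is completely Baire, i.e. every closed subspace of $Z$ is a Baire space. Let $X \subseteq Z$ be a Souslin-$\mathcal F$ set in $Z$, i.e. $X=\bigcup_{\alpha\in\omega^\omega}\bigcap_{n\in\omega}F_{\alpha|n}$ for some family $(F_s)_{s\in\omega^{<\omega}}$ of closed subsets of $Z$, where $\alpha|n=(\alpha(0),\dots,\alpha(n-1))$. Suppose that $X$, with the subspace topology, is first-countable and perfectly paracompact, i.e. $X$ is paracompact and every closed subset of $X$ is a $G_\delta$-set in $X$. Then a map $f\colon X\to Y$ is $\mathbf\Delta^0_2$-measurable (i.e. for every open $U\subseteq Y$ the set $f^{-1}(U)$ is both an $F_\sigma$-set and a $G_\delta$-set in $X$) if and only if it is piecewise continuous (i.e. there are closed subsets $X_0,X_1,\dots$ of $X$ with $X=\bigcup_{n\in\omega}X_n$ such that the restriction $f|X_n$ is continuous for every $n$). -/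

import Mathlib

/-- The result of the `𝒜`-operation (Souslin operation) applied to the family `F` of sets indexed
by finite sequences of natural numbers: the union over all `α : ℕ → ℕ` of the intersections
`⋂ n, F (α 0, …, α (n - 1))`. -/
def souslinOperation {Z : Type*} (F : List ℕ → Set Z) : Set Z :=
  ⋃ α : ℕ → ℕ, ⋂ n : ℕ, F ((List.range n).map α)

/-- `S` is a Souslin-`ℱ` set in `Z`: it is the result of the `𝒜`-operation applied to a system of
closed subsets of `Z`. -/
def IsSouslinF {Z : Type*} [TopologicalSpace Z] (S : Set Z) : Prop :=
  ∃ F : List ℕ → Set Z, (∀ s, IsClosed (F s)) ∧ S = souslinOperation F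

/-- A space is completely Baire if each of its closed subspaces is a Baire space. -/
def CompletelyBaire (Z : Type*) [TopologicalSpace Z] : Prop :=
  ∀ C : Set Z, IsClosed C → BaireSpace C

/-- A space is perfectly paracompact if it is paracompact and each closed subset is `G_δ`.
(`ParacompactSpace` does not include the Hausdorff property.) -/
def PerfectlyParacompact (X : Type*) [TopologicalSpace X] : Prop :=
  ParacompactSpace X ∧ ∀ C : Set X, IsClosed C → IsGδ C

/-- `Σ⁰₂` sets: the unions of countably many closed sets (`F_σ` sets). -/
def IsSigma02 {X : Type*} [TopologicalSpace X] (A : Set X) : Prop :=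
  ∃ C : ℕ → Set X, (∀ n, IsClosed (C n)) ∧ A = ⋃ n, C n

/-- `Δ⁰₂` sets: the sets that are both `F_σ` and `G_δ`. -/
def IsDelta02 {X : Type*} [TopologicalSpace X] (A : Set X) : Prop :=
  IsSigma02 A ∧ IsGδ A

/-- A map is `Δ⁰₂`-measurable if preimages of open sets are `Δ⁰₂`. -/
def Delta02Measurable {X Y : Type*} [TopologicalSpace X] [TopologicalSpace Y] (f : X → Y) : Prop :=
  ∀ U : Set Y, IsOpen U → IsDelta02 (f ⁻¹' U)

/-- A map is piecewise continuous if its domain is covered by a sequence of closed sets such that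
the restriction of the map to each of them is continuous. -/
def PiecewiseContinuous {X Y : Type*} [TopologicalSpace X] [TopologicalSpace Y] (f : X → Y) :
    Prop :=
  ∃ C : ℕ → Set X, (∀ n, IsClosed (C n)) ∧ (⋃ n, C n) = Set.univ ∧ ∀ n, ContinuousOn f (C n)

/-! Small sets form a σ-ideal, and perfect paracompactness makes smallness local. Suppose the domain
is not small. If `B` is not small, `f` cannot be continuous on the closed set `smallSupport f B`. So
at some point `x`, the part of `B` sent away from a neighbourhood of `f x` is non-small arbitrarily
near `x` (`exists_irreducibleOutside_of_not_smallFor`). Iterating, `IsTreeStage.exists_extension`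
grows a tree of points `x n`, each the limit of its children, and an open set `A ⊇ {f (x n)}`
growing with it. Each new piece lies in the piece of its parent, extends its Souslin label, and has
its closure sent outside the part of `A` built so far. A point of `K = closure {x n}` that follows
an infinite branch lies in `X` by the Souslin labels, and `f` sends it outside `A`
(`exists_mem_of_not_eventually`). If `f ⁻¹' A` were `G_δ`, it would be the trace on `X` of a `G_δ`
set dense in `K`. Since `K` is Baire, that set would contain such a point: a contradiction. -/

open Set Filter Topology

/-! ### The σ-ideal of small sets and its locality. -/

section SmallSets

variable {X Y : Type*} [TopologicalSpace X] [TopologicalSpace Y]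

/-- A set is small for `f` if it is covered by countably many closed sets on each of which `f` is
continuous. -/
def SmallFor (f : X → Y) (B : Set X) : Prop :=
  ∃ C : ℕ → Set X, (∀ n, IsClosed (C n)) ∧ (∀ n, ContinuousOn f (C n)) ∧ B ⊆ ⋃ n, C n

theorem smallFor_univ_iff {f : X → Y} : SmallFor f univ ↔ PiecewiseContinuous f := by
  simp only [SmallFor, PiecewiseContinuous, univ_subset_iff]
  constructor
  · rintro ⟨C, h1, h2, h3⟩
    exact ⟨C, h1, h3, h2⟩
  · rintro ⟨C, h1, h2, h3⟩
    exact ⟨C, h1, h3, h2⟩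

theorem SmallFor.mono {f : X → Y} {B B' : Set X} (h : SmallFor f B) (hB : B' ⊆ B) :
    SmallFor f B' := by
  obtain ⟨C, h1, h2, h3⟩ := h
  exact ⟨C, h1, h2, hB.trans h3⟩

theorem smallFor_of_isClosed {f : X → Y} {C : Set X} (hC : IsClosed C) (hf : ContinuousOn f C) :
    SmallFor f C :=
  ⟨fun _ => C, fun _ => hC, fun _ => hf, fun _ hx => mem_iUnion.2 ⟨0, hx⟩⟩

theorem SmallFor.iUnion_nat {f : X → Y} {B : ℕ → Set X} (h : ∀ n, SmallFor f (B n)) :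
    SmallFor f (⋃ n, B n) := by
  choose C h1 h2 h3 using h
  refine ⟨fun k => C k.unpair.1 k.unpair.2, fun k => h1 _ _, fun k => h2 _ _, ?_⟩
  refine iUnion_subset fun n x hx => ?_
  obtain ⟨m, hm⟩ := mem_iUnion.1 (h3 n hx)
  exact mem_iUnion.2 ⟨Nat.pair n m, by simpa using hm⟩

theorem SmallFor.union {f : X → Y} {A B : Set X} (hA : SmallFor f A) (hB : SmallFor f B) :
    SmallFor f (A ∪ B) := by
  refine (SmallFor.iUnion_nat (f := f) (B := fun n => if n = 0 then A else B) fun n => ?_).mono ?_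
  · split_ifs
    exacts [hA, hB]
  · rintro x (hx | hx)
    · exact mem_iUnion.2 ⟨0, by simpa using hx⟩
    · exact mem_iUnion.2 ⟨1, by simpa using hx⟩

theorem smallFor_preimage_of_finite [T1Space Y] {f : X → Y}
    (hc : ∀ C : Set Y, IsClosed C → IsSigma02 (f ⁻¹' C)) {T : Set Y} (hT : T.Finite) :
    SmallFor f (f ⁻¹' T) := by
  induction T, hT using Set.Finite.induction_on with
  | empty => exact (smallFor_of_isClosed isClosed_empty (continuousOn_empty f)).mono (by simp)
  | @insert a s _ _ ih =>
    rw [insert_eq, preimage_union]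
    refine SmallFor.union ?_ ih
    obtain ⟨C, hC, h⟩ := hc {a} isClosed_singleton
    rw [h]
    refine SmallFor.iUnion_nat fun n => smallFor_of_isClosed (hC n) ?_
    refine (continuousOn_const (c := a)).congr fun x hx => ?_
    have : x ∈ f ⁻¹' {a} := h ▸ mem_iUnion.2 ⟨n, hx⟩
    simpa using this

/-- If each point of a closed set has a neighbourhood in which `B` is small, then the trace of `B`
on the closed set is small. -/
theorem smallFor_inter_isClosed_of_locally [RegularSpace X] [ParacompactSpace X] {f : X → Y}
    {B E : Set X} (hE : IsClosed E) (h : ∀ x ∈ E, ∃ V ∈ 𝓝 x, SmallFor f (B ∩ V)) :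
    SmallFor f (B ∩ E) := by
  have h' : ∀ x : E, ∃ V : Set X, IsOpen V ∧ (x : X) ∈ V ∧ SmallFor f (B ∩ closure V) := by
    rintro ⟨x, hx⟩
    obtain ⟨V, hV, hs⟩ := h x hx
    obtain ⟨N, hN, hNc, hNV⟩ := exists_mem_nhds_isClosed_subset hV
    refine ⟨interior N, isOpen_interior, mem_interior_iff_mem_nhds.2 hN, hs.mono ?_⟩
    exact inter_subset_inter_right _ ((closure_minimal interior_subset hNc).trans hNV)
  choose u uo xu us using h'
  obtain ⟨v, vo, Ev, vlf, vu⟩ := precise_refinement_set hE u uo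
    (fun x hx => mem_iUnion.2 ⟨⟨x, hx⟩, xu _⟩)
  choose C hC hCf hCB using us
  -- The cover may be uncountable, so for each `n` the `n`-th closed sets of all its members are
  -- merged; local finiteness keeps the union closed and `f` continuous on it.
  have hlf : ∀ n, LocallyFinite fun x : E => closure (v x) ∩ C x n := fun n =>
    vlf.closure.subset fun x => inter_subset_left
  refine ⟨fun n => ⋃ x : E, closure (v x) ∩ C x n, fun n => ?_, fun n => ?_, ?_⟩
  · exact (hlf n).isClosed_iUnion fun x => isClosed_closure.inter (hC x n)
  · exact (hlf n).continuousOn_iUnion (fun x => isClosed_closure.inter (hC x n))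
      fun x => (hCf x n).mono inter_subset_right
  · rintro y ⟨hyB, hyE⟩
    obtain ⟨x, hx⟩ := mem_iUnion.1 (Ev hyE)
    obtain ⟨n, hn⟩ := mem_iUnion.1 (hCB x ⟨hyB, closure_mono (vu x) (subset_closure hx)⟩)
    exact mem_iUnion.2 ⟨n, mem_iUnion.2 ⟨x, subset_closure hx, hn⟩⟩

theorem IsGδ.isSigma02_compl {A : Set X} (h : IsGδ A) : IsSigma02 Aᶜ := by
  obtain ⟨G, hG, rfl⟩ := isGδ_iff_eq_iInter_nat.1 h
  exact ⟨fun n => (G n)ᶜ, fun n => (hG n).isClosed_compl, by rw [compl_iInter]⟩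

theorem IsSigma02.isGδ_compl {A : Set X} (h : IsSigma02 A) : IsGδ Aᶜ := by
  obtain ⟨C, hC, rfl⟩ := h
  rw [compl_iUnion]
  exact IsGδ.iInter_of_isOpen fun n => (hC n).isOpen_compl

/-! ### Supports and irreducibility. -/

/-- The points in no neighbourhood of which `B` is small. -/
def smallSupport (f : X → Y) (B : Set X) : Set X :=
  {x | ∀ V ∈ 𝓝 x, ¬ SmallFor f (B ∩ V)}

theorem isClosed_smallSupport (f : X → Y) (B : Set X) : IsClosed (smallSupport f B) := by
  rw [← isOpen_compl_iff, isOpen_iff_mem_nhds]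
  intro x hx
  simp only [smallSupport, mem_compl_iff, mem_ofPred_eq, not_forall, not_not] at hx
  obtain ⟨V, hV, hs⟩ := hx
  filter_upwards [eventually_mem_nhds_iff.2 hV] with y hy hy'
  exact hy' V hy hs

theorem smallSupport_subset_closure (f : X → Y) (B : Set X) : smallSupport f B ⊆ closure B := by
  intro x hx
  rw [mem_closure_iff_nhds]
  intro V hV
  rw [inter_comm]
  by_contra h
  rw [not_nonempty_iff_eq_empty] at h
  refine hx V hV ?_
  rw [h]
  exact smallFor_of_isClosed isClosed_empty (continuousOn_empty f)

theorem smallFor_diff_smallSupport [RegularSpace X] (hpp : PerfectlyParacompact X)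
    (f : X → Y) (B : Set X) : SmallFor f (B \ smallSupport f B) := by
  have := hpp.1
  obtain ⟨E, hE, h⟩ := (hpp.2 _ (isClosed_smallSupport f B)).isSigma02_compl
  rw [sdiff_eq, h, inter_iUnion]
  refine SmallFor.iUnion_nat fun n => smallFor_inter_isClosed_of_locally (hE n) fun x hx => ?_
  have hx' : x ∈ (smallSupport f B)ᶜ := h ▸ mem_iUnion.2 ⟨n, hx⟩
  simpa only [smallSupport, mem_compl_iff, mem_ofPred_eq, not_forall, not_not, exists_prop]
    using hx'

/-- The part of `B` which `f` maps outside of `closure A` is not small in any neighbourhood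
of `x`. -/
def IrreducibleOutside (f : X → Y) (x : X) (B : Set X) (A : Set Y) : Prop :=
  ∀ V ∈ 𝓝 x, ¬ SmallFor f (B ∩ V ∩ f ⁻¹' (closure A)ᶜ)

theorem IrreducibleOutside.anti {f : X → Y} {x : X} {B : Set X} {A A' : Set Y}
    (h : IrreducibleOutside f x B A) (hA : A' ⊆ A) : IrreducibleOutside f x B A' := by
  intro V hV hs
  refine h V hV (hs.mono ?_)
  gcongr

/-- No value lies in both closures, so if both alternatives failed, two small sets would cover the
part of `B` near `x` sent outside `closure A`. -/
theorem IrreducibleOutside.union_or_union {f : X → Y} {x : X} {B : Set X} {A U U' : Set Y}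
    (h : IrreducibleOutside f x B A) (hU : Disjoint (closure U) (closure U')) :
    IrreducibleOutside f x B (A ∪ U) ∨ IrreducibleOutside f x B (A ∪ U') := by
  by_contra hcon
  simp only [IrreducibleOutside, not_or, not_forall, not_not, exists_prop] at hcon
  obtain ⟨⟨V, hV, hs⟩, V', hV', hs'⟩ := hcon
  refine h (V ∩ V') (inter_mem hV hV') ((hs.union hs').mono ?_)
  rintro y ⟨⟨hyB, hyV, hyV'⟩, hyA⟩
  simp only [closure_union, mem_union, mem_inter_iff, mem_preimage, mem_compl_iff] at hyA ⊢
  have := fun h : f y ∈ closure U => disjoint_left.1 hU h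
  tauto

theorem exists_isOpen_disjoint_closure {T : Type*} [TopologicalSpace T] [T3Space T] {a b : T}
    (h : a ≠ b) : ∃ U V : Set T, IsOpen U ∧ IsOpen V ∧ a ∈ U ∧ b ∈ V ∧
      Disjoint (closure U) (closure V) := by
  obtain ⟨U, hU, hUo, V, hV, hVo, hd⟩ := exists_open_nhds_disjoint_closure h
  exact ⟨U, V, hUo, hVo, hU, hV, hd⟩

/-- Otherwise `f` is continuous on the support: if `x'` near `x` had `f x'` outside a closed
neighbourhood `N` of `f x`, then with `M` a closed neighbourhood of `f x'` disjoint from `N`, points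
near `x'` avoid `N` or `M`, and both parts of `B` are small. -/
theorem exists_irreducibleOutside_of_not_smallFor [RegularSpace X] [RegularSpace Y]
    (hpp : PerfectlyParacompact X) {f : X → Y} {B : Set X} (hB : ¬ SmallFor f B) :
    ∃ x ∈ smallSupport f B, ∃ U : Set Y, IsOpen U ∧ f x ∈ U ∧ IrreducibleOutside f x B U := by
  by_contra hcon
  push Not at hcon
  refine hB (((smallFor_diff_smallSupport hpp f B).union (smallFor_of_isClosed
    (isClosed_smallSupport f B) ?_)).mono fun x hx => ?_)
  · intro x hx
    refine (closed_nhds_basis (f x)).tendsto_right_iff.2 ?_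
    rintro N ⟨hN, hNc⟩
    have h1 := hcon x hx (interior N) isOpen_interior (mem_interior_iff_mem_nhds.2 hN)
    simp only [IrreducibleOutside, not_forall, not_not, exists_prop] at h1
    obtain ⟨V, hV, hs⟩ := h1
    filter_upwards [nhdsWithin_le_nhds (eventually_mem_nhds_iff.2 hV), self_mem_nhdsWithin]
      with x' hx'V hx'
    by_contra hx'N
    obtain ⟨M, hM, hMc, hMN⟩ := exists_mem_nhds_isClosed_subset (hNc.isOpen_compl.mem_nhds hx'N)
    have h2 := hcon x' hx' (interior M) isOpen_interior (mem_interior_iff_mem_nhds.2 hM)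
    simp only [IrreducibleOutside, not_forall, not_not, exists_prop] at h2
    obtain ⟨V', hV', hs'⟩ := h2
    refine hx' (V ∩ V') (inter_mem hx'V hV') ((hs.union hs').mono ?_)
    rintro y ⟨hyB, hyV, hyV'⟩
    have h3 := closure_minimal (interior_subset (s := N)) hNc
    have h4 := (closure_minimal (interior_subset (s := M)) hMc).trans hMN
    by_cases hy : f y ∈ N
    · exact Or.inr ⟨⟨hyB, hyV'⟩, fun h => h4 h hy⟩
    · exact Or.inl ⟨⟨hyB, hyV⟩, fun h => hy (h3 h)⟩
  · by_cases h : x ∈ smallSupport f B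
    · exact Or.inr h
    · exact Or.inl ⟨hx, h⟩

theorem not_smallFor_inter_of_subset_iUnion {f : X → Y} {B : Set X} {E : ℕ → Set X}
    (hB : ¬ SmallFor f B) (h : B ⊆ ⋃ n, E n) : ∃ n, ¬ SmallFor f (B ∩ E n) := by
  by_contra hcon
  push Not at hcon
  refine hB ((SmallFor.iUnion_nat hcon).mono ?_)
  rw [← inter_iUnion]
  exact subset_inter subset_rfl h

/-- The values of `f` at points at which `f` is irreducible form an infinite set. -/
theorem infinite_irreducible_values [RegularSpace X] [T3Space Y] (hpp : PerfectlyParacompact X)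
    {f : X → Y} (ho : ∀ U : Set Y, IsOpen U → IsSigma02 (f ⁻¹' U))
    (hc : ∀ C : Set Y, IsClosed C → IsSigma02 (f ⁻¹' C)) {B : Set X} (hB : ¬ SmallFor f B) :
    {y : Y | ∃ x P U, f x = y ∧ P ⊆ B ∧ x ∈ closure P ∧ IsOpen U ∧ y ∈ U ∧
      IrreducibleOutside f x P U}.Infinite := by
  intro hfin
  set T := {y : Y | ∃ x P U, f x = y ∧ P ⊆ B ∧ x ∈ closure P ∧ IsOpen U ∧ y ∈ U ∧
      IrreducibleOutside f x P U} with hT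
  have h1 : ¬ SmallFor f (B ∩ f ⁻¹' Tᶜ) := fun hs =>
    hB ((hs.union (smallFor_preimage_of_finite hc hfin)).mono fun x hx => by
      by_cases h : f x ∈ T
      · exact Or.inr h
      · exact Or.inl ⟨hx, h⟩)
  -- Passing to a closed piece on which `f` avoids `T` keeps the new value, taken at a point of the
  -- closure, outside `T`.
  obtain ⟨E, hE, hEU⟩ := ho Tᶜ hfin.isClosed.isOpen_compl
  obtain ⟨n, hn⟩ := not_smallFor_inter_of_subset_iUnion h1 (inter_subset_right.trans hEU.subset)
  obtain ⟨x, hx, U, hU, hxU, hirr⟩ := exists_irreducibleOutside_of_not_smallFor hpp hn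
  have hxc := smallSupport_subset_closure f _ hx
  have hxE : x ∈ E n := closure_minimal inter_subset_right (hE n) hxc
  have hxT : x ∈ f ⁻¹' Tᶜ := hEU ▸ mem_iUnion.2 ⟨n, hxE⟩
  exact hxT ⟨x, _, U, rfl, inter_subset_left.trans inter_subset_left, hxc, hU, hxU, hirr⟩

/-- A new point of irreducibility can be found in such a way that finitely many given points of
irreducibility persist. -/
theorem exists_irreducibleOutside_union [RegularSpace X] [T3Space Y]
    (hpp : PerfectlyParacompact X)
    {f : X → Y} (ho : ∀ U : Set Y, IsOpen U → IsSigma02 (f ⁻¹' U))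
    (hc : ∀ C : Set Y, IsClosed C → IsSigma02 (f ⁻¹' C)) {ι : Type*} {I : Set ι} (hI : I.Finite)
    (x : ι → X) (P : ι → Set X) (A : Set Y) (hirr : ∀ i ∈ I, IrreducibleOutside f (x i) (P i) A)
    {B : Set X} (hB : ¬ SmallFor f B) (hBA : B ⊆ f ⁻¹' (closure A)ᶜ) :
    ∃ (x' : X) (P' : Set X) (U : Set Y), P' ⊆ B ∧ x' ∈ closure P' ∧ IsOpen U ∧ f x' ∈ U ∧
      IrreducibleOutside f x' P' (A ∪ U) ∧
      ∀ i ∈ I, IrreducibleOutside f (x i) (P i) (A ∪ U) := by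
  -- Each `i` spoils at most one value, since two values have neighbourhoods with disjoint closures;
  -- infinitely many candidates remain.
  have hbad : (⋃ i ∈ I, {y : Y | ∀ U, IsOpen U → y ∈ U →
      ¬ IrreducibleOutside f (x i) (P i) (A ∪ U)}).Finite := by
    refine hI.biUnion fun i hi => Set.Subsingleton.finite fun a ha b hb => ?_
    by_contra hab
    obtain ⟨U, V, hU, hV, haU, hbV, hd⟩ := exists_isOpen_disjoint_closure hab
    rcases (hirr i hi).union_or_union hd with h | h
    · exact ha U hU haU h
    · exact hb V hV hbV h
  obtain ⟨y, ⟨x', P', U, rfl, hP, hx', hU, hxU, hx'irr⟩, hy⟩ :=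
    ((infinite_irreducible_values hpp ho hc hB).sdiff hbad).nonempty
  simp only [mem_iUnion, mem_ofPred_eq, not_exists] at hy
  push Not at hy
  choose! W hWo hyW hW using hy
  refine ⟨x', P', U ∩ ⋂ i ∈ I, W i, hP, hx', hU.inter (hI.isOpen_biInter hWo),
    ⟨hxU, mem_iInter₂.2 hyW⟩, ?_, fun i hi => (hW i hi).anti ?_⟩
  · intro V hV hs
    refine hx'irr V hV (hs.mono ?_)
    rintro z ⟨⟨hzP, hzV⟩, hzU⟩
    refine ⟨⟨hzP, hzV⟩, ?_⟩
    rw [closure_union]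
    rintro (h | h)
    · exact hBA (hP hzP) h
    · exact hzU (closure_mono inter_subset_left h)
  · exact union_subset_union_right _ (inter_subset_right.trans (biInter_subset_of_mem hi))

/-! ### The easy implication. -/

theorem PiecewiseContinuous.delta02Measurable (hX : ∀ C : Set X, IsClosed C → IsGδ C) {f : X → Y}
    (h : PiecewiseContinuous f) : Delta02Measurable f := by
  obtain ⟨C, hC, hcov, hf⟩ := h
  have hcov' : ∀ x, ∃ n, x ∈ C n := fun x => mem_iUnion.1 (hcov ▸ mem_univ x)
  intro U hU
  constructor
  · have h1 : ∀ n, ∃ O : Set X, IsOpen O ∧ f ⁻¹' U ∩ C n = O ∩ C n := fun n =>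
      continuousOn_iff'.1 (hf n) U hU
    choose O hO hOC using h1
    have h2 : ∀ n, IsSigma02 (O n) := fun n => by
      simpa using (hX _ (hO n).isClosed_compl).isSigma02_compl
    choose E hE hEO using h2
    refine ⟨fun k => E k.unpair.1 k.unpair.2 ∩ C k.unpair.1, fun k => (hE _ _).inter (hC _), ?_⟩
    ext x
    simp only [mem_iUnion]
    constructor
    · intro hx
      obtain ⟨n, hn⟩ := hcov' x
      have h3 : x ∈ O n ∩ C n := hOC n ▸ ⟨hx, hn⟩
      obtain ⟨m, hm⟩ := mem_iUnion.1 (hEO n ▸ h3.1)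
      exact ⟨Nat.pair n m, by simpa using ⟨hm, hn⟩⟩
    · rintro ⟨k, hk1, hk2⟩
      have h3 : x ∈ O k.unpair.1 ∩ C k.unpair.1 := ⟨hEO k.unpair.1 ▸ mem_iUnion.2 ⟨_, hk1⟩, hk2⟩
      rw [← hOC] at h3
      exact h3.1
  · have h1 : IsSigma02 (f ⁻¹' Uᶜ) := by
      refine ⟨fun n => C n ∩ f ⁻¹' Uᶜ, fun n =>
        (hf n).preimage_isClosed_of_isClosed (hC n) hU.isClosed_compl, ?_⟩
      rw [← iUnion_inter, hcov, univ_inter]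
    simpa using h1.isGδ_compl

end SmallSets

/-! ### Souslin sections and the inductive construction. -/

section Construction

/-- The result of the Souslin operation restricted to the branches that extend `t`. -/
def souslinSection {Z : Type*} (F : List ℕ → Set Z) (t : List ℕ) : Set Z :=
  {x | ∃ α : ℕ → ℕ, (List.range t.length).map α = t ∧ ∀ m, x ∈ F ((List.range m).map α)}

theorem souslinSection_nil {Z : Type*} (F : List ℕ → Set Z) : souslinSection F [] = souslinOperation F := by
  ext x
  simp [souslinSection, souslinOperation]

theorem souslinSection_subset_iUnion {Z : Type*} (F : List ℕ → Set Z) (t : List ℕ) :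
    souslinSection F t ⊆ ⋃ k, souslinSection F (t ++ [k]) := by
  rintro x ⟨α, h, hx⟩
  exact mem_iUnion.2 ⟨α t.length, α, by simp [List.range_succ, h], hx⟩

theorem souslinSection_subset_take {Z : Type*} (F : List ℕ → Set Z) (t : List ℕ) {k : ℕ}
    (hk : k ≤ t.length) :
    souslinSection F t ⊆ F (t.take k) := by
  rintro x ⟨α, h, hx⟩
  have : t.take k = (List.range k).map α := by
    conv_lhs => rw [← h]
    rw [← List.map_take, List.take_range, min_eq_left hk]
  rw [this]
  exact hx k

/-- An increasing sequence of finite sequences with unbounded lengths determines a branch. -/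
theorem exists_branch_of_prefix {t : ℕ → List ℕ} (h : ∀ m, t m <+: t (m + 1))
    (hl : ∀ k, ∃ m, k ≤ (t m).length) :
    ∃ α : ℕ → ℕ, ∀ k, ∃ m, k ≤ (t m).length ∧ (t m).take k = (List.range k).map α := by
  have hmono : ∀ i j, i ≤ j → t i <+: t j := fun i j hij => by
    induction j, hij using Nat.le_induction with
    | base => exact List.prefix_rfl
    | succ j _ ih => exact ih.trans (h j)
  have hget : ∀ i j k (hi : k < (t i).length) (hj : k < (t j).length),
      (t i)[k] = (t j)[k] := fun i j k hi hj => by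
    rcases le_total i j with hij | hij
    · exact (hmono i j hij).getElem hi
    · exact ((hmono j i hij).getElem hj).symm
  choose M hM using fun k => hl (k + 1)
  refine ⟨fun k => (t (M k))[k]'(hM k), fun k => ?_⟩
  obtain ⟨m, hm⟩ := hl k
  refine ⟨m, hm, List.ext_getElem (by simp [hm]) fun j h1 h2 => ?_⟩
  simp only [List.getElem_take, List.getElem_map, List.getElem_range]
  exact hget _ _ _ _ _

variable {Y Z : Type*} [TopologicalSpace Y] [TopologicalSpace Z]

/-- The data of the inductive construction: points, sets in which later points accumulate, their
Souslin labels, an open set that contains the values at the points, and neighbourhoods. -/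
structure TreeStage {Z : Type*} (X : Set Z) (Y : Type*) where
  point : ℕ → X
  piece : ℕ → Set X
  label : ℕ → List ℕ
  image : Set Y
  nhd : ℕ → Set Z

/-- The invariants of the construction for the points with index at most `n`. -/
structure IsTreeStage {X : Set Z} (F : List ℕ → Set Z) (f : X → Y) (n : ℕ)
    (s : TreeStage X Y) : Prop where
  irreducible : ∀ i ≤ n, IrreducibleOutside f (s.point i) (s.piece i) s.image
  isOpen_image : IsOpen s.image
  mem_image : ∀ i ≤ n, f (s.point i) ∈ s.image
  isOpen_nhd : ∀ i ≤ n, IsOpen (s.nhd i)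
  mem_nhd : ∀ i ≤ n, (s.point i : Z) ∈ s.nhd i
  disjoint_nhd : ∀ i ≤ n, ∀ j ≤ n, i ≠ j → Disjoint (closure (s.nhd i)) (closure (s.nhd j))
  mem_closure : ∀ i ≤ n, s.point i ∈ closure (s.piece i)
  piece_subset : ∀ i ≤ n, ∀ x ∈ s.piece i, (x : Z) ∈ souslinSection F (s.label i)

/-- The relation of consecutive stages: the point with index `n + 1` is chosen in the piece of the
point with index `p` and in the `n`-th set of the neighbourhood base `b` at that point. -/
structure IsTreeExtension {X : Set Z} (f : X → Y) (b : X → ℕ → Set X) (n p : ℕ)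
    (s s' : TreeStage X Y) : Prop where
  point_eq : ∀ i ≤ n, s'.point i = s.point i
  piece_eq : ∀ i ≤ n, s'.piece i = s.piece i
  label_eq : ∀ i ≤ n, s'.label i = s.label i
  mem_base : s'.point (n + 1) ∈ b (s.point p) n
  piece_subset : s'.piece (n + 1) ⊆ s.piece p
  label_succ : ∃ k, s'.label (n + 1) = s.label p ++ [k]
  notMem_image : ∀ z ∈ closure (s'.piece (n + 1)), f z ∉ s.image
  image_subset : s.image ⊆ s'.image
  nhd_subset : ∀ i ≤ n, s'.nhd i ⊆ s.nhd i
  nhd_succ_subset : s'.nhd (n + 1) ⊆ s.nhd p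

variable {X : Set Z} {F : List ℕ → Set Z} {f : X → Y}

theorem exists_isTreeStage_zero [RegularSpace X] [T3Space Y] (hpp : PerfectlyParacompact X)
    (ho : ∀ U : Set Y, IsOpen U → IsSigma02 (f ⁻¹' U))
    (hc : ∀ C : Set Y, IsClosed C → IsSigma02 (f ⁻¹' C)) (hX : X = souslinOperation F)
    (hf : ¬ SmallFor f univ) : ∃ s : TreeStage X Y, IsTreeStage F f 0 s := by
  obtain ⟨x, P, U, -, hx, hU, hxU, hirr, -⟩ := exists_irreducibleOutside_union hpp ho hc
    (finite_empty (α := ℕ)) (fun _ => Classical.choice (by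
      by_contra h
      rw [not_nonempty_iff] at h
      exact hf ((smallFor_of_isClosed isClosed_empty (continuousOn_empty f)).mono
        fun x => isEmptyElim x) : Nonempty X)) (fun _ => univ) ∅ (by simp) hf (by simp)
  rw [empty_union] at hirr
  refine ⟨⟨fun _ => x, fun _ => P, fun _ => [], U, fun _ => univ⟩, fun i _ => hirr, hU,
    fun i _ => hxU, fun i _ => isOpen_univ, fun i _ => mem_univ _, fun i hi j hj hij => ?_,
    fun i _ => hx, fun i _ y _ => ?_⟩
  · omega
  · rw [souslinSection_nil, ← hX]
    exact y.2

theorem IsTreeStage.exists_extension [T3Space Z] [T3Space Y] (hpp : PerfectlyParacompact X)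
    (ho : ∀ U : Set Y, IsOpen U → IsSigma02 (f ⁻¹' U))
    (hc : ∀ C : Set Y, IsClosed C → IsSigma02 (f ⁻¹' C)) {b : X → ℕ → Set X}
    (hb : ∀ x n, b x n ∈ 𝓝 x) {n p : ℕ} (hp : p ≤ n) {s : TreeStage X Y}
    (hs : IsTreeStage F f n s) :
    ∃ s', IsTreeStage F f (n + 1) s' ∧ IsTreeExtension f b n p s s' := by
  obtain ⟨N, hN, hNc, hNs⟩ := exists_mem_nhds_isClosed_subset (inter_mem (hb (s.point p) n)
    (((hs.isOpen_nhd p hp).preimage continuous_subtype_val).mem_nhds (hs.mem_nhd p hp)))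
  -- A closed piece `E e` of this `F_σ` set makes even the closure of the new piece avoid `s.image`
  -- under `f`.
  obtain ⟨E, hE, hEU⟩ := ho (closure s.image)ᶜ isClosed_closure.isOpen_compl
  obtain ⟨e, he⟩ := not_smallFor_inter_of_subset_iUnion (hs.irreducible p hp N hN)
    (inter_subset_right.trans hEU.subset)
  obtain ⟨k, hk⟩ := not_smallFor_inter_of_subset_iUnion he
    (E := fun k => (↑) ⁻¹' souslinSection F (s.label p ++ [k])) (fun x hx => by
      rw [← preimage_iUnion]
      exact souslinSection_subset_iUnion F _ (hs.piece_subset p hp x hx.1.1.1))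
  obtain ⟨x, P, U, hP, hx, hU, hxU, hirr, hirr'⟩ := exists_irreducibleOutside_union hpp ho hc
    (finite_Iic n) s.point s.piece s.image hs.irreducible hk fun x hx => hx.1.1.2
  have hPE : closure P ⊆ E e := closure_minimal (fun x hx => (hP hx).1.2) (hE e)
  have hPN : closure P ⊆ N := closure_minimal (fun x hx => (hP hx).1.1.1.2) hNc
  have hPA : ∀ z ∈ closure P, f z ∉ s.image := fun z hz hzA => by
    have h1 : z ∈ f ⁻¹' (closure s.image)ᶜ := hEU ▸ mem_iUnion.2 ⟨e, hPE hz⟩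
    exact h1 (subset_closure hzA)
  have hne : (s.point p : Z) ≠ x := fun h =>
    hPA x hx (Subtype.ext h ▸ hs.mem_image p hp)
  obtain ⟨G, G', hG, hG', hpG, hxG', hGG⟩ := exists_isOpen_disjoint_closure hne
  have hxV : (x : Z) ∈ s.nhd p := (hNs (hPN hx)).2
  -- Only the parent's neighbourhood is split, between the parent and its new child.
  let V : ℕ → Set Z := fun i =>
    if i = n + 1 then s.nhd p ∩ G' else if i = p then s.nhd p ∩ G else s.nhd i
  have hVn : V (n + 1) = s.nhd p ∩ G' := if_pos rfl
  have hVp : V p = s.nhd p ∩ G := by simp [V, show p ≠ n + 1 by omega]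
  have hVi : ∀ i ≤ n, i ≠ p → V i = s.nhd i := fun i hi hip => by
    simp [V, hip, show i ≠ n + 1 by omega]
  have hVs : ∀ i ≤ n, V i ⊆ s.nhd i := fun i hi => by
    rcases eq_or_ne i p with rfl | h
    · exact hVp ▸ inter_subset_left
    · exact (hVi i hi h).subset
  have hdisj : ∀ i ≤ n, Disjoint (closure (V i)) (closure (V (n + 1))) := fun i hi => by
    rw [hVn]
    rcases eq_or_ne i p with rfl | h
    · rw [hVp]
      exact hGG.mono (closure_mono inter_subset_right) (closure_mono inter_subset_right)
    · rw [hVi i hi h]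
      exact (hs.disjoint_nhd i hi p hp h).mono_right (closure_mono inter_subset_left)
  have hcases : ∀ {i}, i ≤ n + 1 → i ≤ n ∨ i = n + 1 := fun h => by omega
  have hsucc : ∀ {i}, i ≤ n → i ≠ n + 1 := fun h => by omega
  refine ⟨⟨Function.update s.point (n + 1) x, Function.update s.piece (n + 1) P,
    Function.update s.label (n + 1) (s.label p ++ [k]), s.image ∪ U, V⟩, ?_, ?_⟩
  · constructor
    · intro i hi
      rcases hcases hi with h | rfl
      · simpa [hsucc h] using hirr' i h
      · simpa using hirr
    · exact hs.isOpen_image.union hU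
    · intro i hi
      rcases hcases hi with h | rfl
      · simpa [hsucc h] using Or.inl (hs.mem_image i h)
      · simpa using Or.inr hxU
    · intro i hi
      rcases hcases hi with h | rfl
      · rcases eq_or_ne i p with rfl | h'
        · change IsOpen (V i)
          exact hVp ▸ (hs.isOpen_nhd i h).inter hG
        · change IsOpen (V i)
          exact hVi i h h' ▸ hs.isOpen_nhd i h
      · change IsOpen (V (n + 1))
        exact hVn ▸ (hs.isOpen_nhd p hp).inter hG'
    · intro i hi
      rcases hcases hi with h | rfl
      · simp only [Function.update_of_ne (hsucc h)]
        rcases eq_or_ne i p with rfl | h'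
        · exact hVp ▸ ⟨hs.mem_nhd i h, hpG⟩
        · exact hVi i h h' ▸ hs.mem_nhd i h
      · simp only [Function.update_self]
        exact hVn ▸ ⟨hxV, hxG'⟩
    · intro i hi j hj hij
      rcases hcases hi with h | rfl <;> rcases hcases hj with h' | rfl
      · exact (hs.disjoint_nhd i h j h' hij).mono (closure_mono (hVs i h))
          (closure_mono (hVs j h'))
      · exact hdisj i h
      · exact (hdisj j h').symm
      · exact absurd rfl hij
    · intro i hi
      rcases hcases hi with h | rfl
      · simpa [hsucc h] using hs.mem_closure i h
      · simpa using hx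
    · intro i hi
      rcases hcases hi with h | rfl
      · simp only [Function.update_of_ne (hsucc h)]
        exact hs.piece_subset i h
      · simp only [Function.update_self]
        exact fun y hy => (hP hy).2
  · constructor
    · exact fun i hi => Function.update_of_ne (hsucc hi) _ _
    · exact fun i hi => Function.update_of_ne (hsucc hi) _ _
    · exact fun i hi => Function.update_of_ne (hsucc hi) _ _
    · simpa using (hNs (hPN hx)).1
    · simp only [Function.update_self]
      exact fun y hy => (hP hy).1.1.1.1
    · exact ⟨k, by simp⟩
    · simpa using hPA
    · exact subset_union_left
    · exact hVs
    · exact hVn.subset.trans inter_subset_left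

theorem exists_seq_of_step {α : Type*} {R : ℕ → α → Prop} {S : ℕ → α → α → Prop}
    (h0 : ∃ a, R 0 a) (h : ∀ n a, R n a → ∃ a', R (n + 1) a' ∧ S n a a') :
    ∃ σ : ℕ → α, (∀ n, R n (σ n)) ∧ ∀ n, S n (σ n) (σ (n + 1)) := by
  choose! g hg using h
  obtain ⟨a, ha⟩ := h0
  let σ : ℕ → α := fun n => Nat.rec a (fun n b => g n b) n
  have hσ : ∀ n, R n (σ n) := fun n => by
    induction n with
    | zero => exact ha
    | succ n ih => exact (hg n _ ih).1
  exact ⟨σ, hσ, fun n => (hg n _ (hσ n)).2⟩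

end Construction

/-! ### Limit points of the tree and the Baire category argument. -/

section Limit

variable {Y Z : Type*} [TopologicalSpace Y] [TopologicalSpace Z] {X : Set Z}

/-- The outcome of the inductive construction. The point with index `n + 1` is chosen near the
point with index `n.unpair.1`. -/
structure IsLimitTree (F : List ℕ → Set Z) (f : X → Y) (b : X → ℕ → Set X) (x : ℕ → X)
    (P : ℕ → Set X) (t : ℕ → List ℕ) (A : ℕ → Set Y) (V : ℕ → ℕ → Set Z) : Prop where
  isOpen_image : ∀ n, IsOpen (A n)
  mem_image : ∀ n, f (x n) ∈ A n
  image_mono : Monotone A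
  mem_nhd : ∀ n, ∀ i ≤ n, (x i : Z) ∈ V n i
  disjoint_nhd : ∀ n, ∀ i ≤ n, ∀ j ≤ n, i ≠ j → Disjoint (closure (V n i)) (closure (V n j))
  nhd_subset : ∀ n, ∀ i ≤ n, V (n + 1) i ⊆ V n i
  nhd_succ_subset : ∀ n, V (n + 1) (n + 1) ⊆ V n n.unpair.1
  mem_base : ∀ n, x (n + 1) ∈ b (x n.unpair.1) n
  mem_closure : ∀ n, x n ∈ closure (P n)
  piece_subset : ∀ n, P (n + 1) ⊆ P n.unpair.1
  piece_subset_section : ∀ n, ∀ y ∈ P n, (y : Z) ∈ souslinSection F (t n)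
  label_succ : ∀ n, ∃ k, t (n + 1) = t n.unpair.1 ++ [k]
  notMem_image : ∀ n, ∀ z ∈ closure (P (n + 1)), f z ∉ A n

theorem exists_isLimitTree [T3Space Z] [T3Space Y] (hpp : PerfectlyParacompact X)
    {F : List ℕ → Set Z} {f : X → Y} (ho : ∀ U : Set Y, IsOpen U → IsSigma02 (f ⁻¹' U))
    (hc : ∀ C : Set Y, IsClosed C → IsSigma02 (f ⁻¹' C)) (hX : X = souslinOperation F)
    (hf : ¬ SmallFor f univ) {b : X → ℕ → Set X} (hb : ∀ x n, b x n ∈ 𝓝 x) :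
    ∃ x P t A V, IsLimitTree F f b x P t A V := by
  obtain ⟨σ, hσ, hstep⟩ := exists_seq_of_step (R := IsTreeStage F f)
    (S := fun n => IsTreeExtension f b n n.unpair.1)
    (exists_isTreeStage_zero hpp ho hc hX hf)
    fun n s hs => hs.exists_extension hpp ho hc hb (Nat.unpair_left_le n)
  have hx : ∀ i n, i ≤ n → (σ n).point i = (σ i).point i := fun i n hin => by
    induction n, hin using Nat.le_induction with
    | base => rfl
    | succ n hin ih => rw [(hstep n).point_eq i hin, ih]
  have hP : ∀ i n, i ≤ n → (σ n).piece i = (σ i).piece i := fun i n hin => by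
    induction n, hin using Nat.le_induction with
    | base => rfl
    | succ n hin ih => rw [(hstep n).piece_eq i hin, ih]
  have ht : ∀ i n, i ≤ n → (σ n).label i = (σ i).label i := fun i n hin => by
    induction n, hin using Nat.le_induction with
    | base => rfl
    | succ n hin ih => rw [(hstep n).label_eq i hin, ih]
  have hp := Nat.unpair_left_le
  exact ⟨fun n => (σ n).point n, fun n => (σ n).piece n, fun n => (σ n).label n,
    fun n => (σ n).image, fun n => (σ n).nhd,
    { isOpen_image := fun n => (hσ n).isOpen_image
      mem_image := fun n => (hσ n).mem_image n le_rfl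
      image_mono := monotone_nat_of_le_succ fun n => (hstep n).image_subset
      mem_nhd := fun n i hi => hx i n hi ▸ (hσ n).mem_nhd i hi
      disjoint_nhd := fun n => (hσ n).disjoint_nhd
      nhd_subset := fun n => (hstep n).nhd_subset
      nhd_succ_subset := fun n => (hstep n).nhd_succ_subset
      mem_base := fun n => hx _ n (hp n) ▸ (hstep n).mem_base
      mem_closure := fun n => (hσ n).mem_closure n le_rfl
      piece_subset := fun n => hP _ n (hp n) ▸ (hstep n).piece_subset
      piece_subset_section := fun n => (hσ n).piece_subset n le_rfl
      label_succ := fun n => ht _ n (hp n) ▸ (hstep n).label_succ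
      notMem_image := fun n => (hstep n).notMem_image }⟩

namespace IsLimitTree

variable {F : List ℕ → Set Z} {f : X → Y} {b : X → ℕ → Set X} {x : ℕ → X} {P : ℕ → Set X}
  {t : ℕ → List ℕ} {A : ℕ → Set Y} {V : ℕ → ℕ → Set Z}

theorem eq_of_mem_closure (h : IsLimitTree F f b x P t A V) {n i j : ℕ} (hi : i ≤ n) (hj : j ≤ n)
    {z : Z} (hzi : z ∈ closure (V n i)) (hzj : z ∈ closure (V n j)) : i = j := by
  by_contra hij
  exact disjoint_left.1 (h.disjoint_nhd n i hi j hj hij) hzi hzj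

theorem nhd_anti (h : IsLimitTree F f b x P t A V) {i m n : ℕ} (hi : i ≤ m) (hmn : m ≤ n) :
    V n i ⊆ V m i := by
  induction n, hmn using Nat.le_induction with
  | base => rfl
  | succ n hmn ih => exact (h.nhd_subset n i (hi.trans hmn)).trans ih

/-- Trace `x j` back through its ancestors until the index is at most `n`; neighbourhoods and pieces
only grow on the way. -/
theorem exists_mem_nhd (h : IsLimitTree F f b x P t A V) (j n : ℕ) :
    ∃ i ≤ n, (x j : Z) ∈ V n i ∧ x j ∈ closure (P i) := by
  rcases le_total j n with hj | hj
  · exact ⟨j, hj, h.mem_nhd n j hj, h.mem_closure j⟩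
  · induction hj using Nat.decreasingInduction with
    | self => exact ⟨j, le_rfl, h.mem_nhd j j le_rfl, h.mem_closure j⟩
    | of_succ n hn ih =>
      obtain ⟨i, hi, hV, hP⟩ := ih
      rcases Nat.le_succ_iff.1 hi with hi | rfl
      · exact ⟨i, hi, h.nhd_subset n i hi hV, hP⟩
      · exact ⟨_, Nat.unpair_left_le n, h.nhd_succ_subset n hV,
          closure_mono (h.piece_subset n) hP⟩

theorem exists_mem_closure_nhd (h : IsLimitTree F f b x P t A V) {z : Z}
    (hz : z ∈ closure (range fun j => (x j : Z))) (n : ℕ) :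
    ∃ i ≤ n, z ∈ closure (V n i) ∧ z ∈ closure ((↑) '' P i) := by
  have hsub : (range fun j => (x j : Z)) ⊆ ⋃ i ∈ Iic n, V n i ∩ closure ((↑) '' P i) := by
    rintro _ ⟨j, rfl⟩
    obtain ⟨i, hi, hV, hP⟩ := h.exists_mem_nhd j n
    exact mem_iUnion₂.2 ⟨i, hi, hV, closure_subtype.1 hP⟩
  have hz' := closure_mono hsub hz
  rw [(finite_Iic n).closure_biUnion] at hz'
  obtain ⟨i, hi, hzi⟩ := mem_iUnion₂.1 hz'
  exact ⟨i, hi, closure_mono inter_subset_left hzi,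
    closure_minimal inter_subset_right isClosed_closure hzi⟩

/-- The limit points that do not stay in the neighbourhoods of a single point belong to `X`, and
`f` maps them outside of the constructed open set. -/
theorem exists_mem_of_not_eventually (h : IsLimitTree F f b x P t A V) (hF : ∀ s, IsClosed (F s))
    (hX : X = souslinOperation F) {z : Z} (hz : z ∈ closure (range fun j => (x j : Z)))
    (hzV : ∀ i, ∃ n ≥ i, z ∉ closure (V n i)) :
    ∃ hzX : z ∈ X, ∀ n, f ⟨z, hzX⟩ ∉ A n := by
  choose ι hι hιV hιP using h.exists_mem_closure_nhd hz
  -- By disjointness of the neighbourhoods, `ι` either stays put or moves to a child: it traces a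
  -- path in the tree.
  have hsucc : ∀ n, ι (n + 1) = ι n ∨ ι (n + 1) = n + 1 ∧ n.unpair.1 = ι n := fun n => by
    rcases Nat.le_succ_iff.1 (hι (n + 1)) with hn | hn
    · exact Or.inl (h.eq_of_mem_closure hn (hι n)
        (closure_mono (h.nhd_subset n _ hn) (hιV (n + 1))) (hιV n))
    · refine Or.inr ⟨hn, h.eq_of_mem_closure (Nat.unpair_left_le n) (hι n) ?_ (hιV n)⟩
      have h1 := hιV (n + 1)
      rw [hn] at h1
      exact closure_mono (h.nhd_succ_subset n) h1
  -- The path moves infinitely often, since `z` eventually leaves the neighbourhoods of any fixed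
  -- point.
  have hjump : ∀ m, ∃ n ≥ m, ι (n + 1) = n + 1 ∧ n.unpair.1 = ι n ∧ ι n = ι m := fun m => by
    by_contra hcon
    push Not at hcon
    have hconst : ∀ n ≥ m, ι n = ι m := fun n hn => by
      induction n, hn using Nat.le_induction with
      | base => rfl
      | succ n hn ih =>
        rcases hsucc n with h1 | ⟨h1, h2⟩
        · rw [h1, ih]
        · exact absurd ih (hcon n hn h1 h2)
    obtain ⟨n, hn, hzn⟩ := hzV (ι m)
    have h1 := hιV (max n m)
    rw [hconst _ (le_max_right n m)] at h1
    exact hzn (closure_mono (h.nhd_anti hn (le_max_left n m)) h1)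
  have hprefix : ∀ n, t (ι n) <+: t (ι (n + 1)) := fun n => by
    rcases hsucc n with h1 | ⟨h1, h2⟩
    · rw [h1]
    · obtain ⟨k, hk⟩ := h.label_succ n
      rw [h1, hk, h2]
      exact List.prefix_append _ _
  have hlength : ∀ k, ∃ m, k ≤ (t (ι m)).length := fun k => by
    induction k with
    | zero => exact ⟨0, Nat.zero_le _⟩
    | succ k ih =>
      obtain ⟨m, hm⟩ := ih
      obtain ⟨n, -, h1, h2, h3⟩ := hjump m
      obtain ⟨a, ha⟩ := h.label_succ n
      refine ⟨n + 1, ?_⟩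
      rw [h1, ha, h2, h3]
      simpa using hm
  obtain ⟨α, hα⟩ := exists_branch_of_prefix hprefix hlength
  have hzX : z ∈ X := by
    rw [hX]
    refine mem_iUnion.2 ⟨α, mem_iInter.2 fun k => ?_⟩
    obtain ⟨m, hm, hk⟩ := hα k
    rw [← hk]
    refine closure_minimal ?_ (hF _) (hιP m)
    rintro _ ⟨y, hy, rfl⟩
    exact souslinSection_subset_take F _ hm (h.piece_subset_section _ y hy)
  refine ⟨hzX, fun n hn => ?_⟩
  obtain ⟨m, hm, h1, -⟩ := hjump n
  refine h.notMem_image m ⟨z, hzX⟩ ?_ (h.image_mono hm hn)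
  rw [closure_subtype, ← h1]
  exact hιP (m + 1)

/-- The stages `Nat.pair i k` all give children of `x i`, and these enter ever smaller members of
the base at `x i`. -/
theorem exists_ne_mem (h : IsLimitTree F f b x P t A V) (hb : ∀ y, (𝓝 y).HasAntitoneBasis (b y))
    {O : Set Z} (hO : IsOpen O) {i : ℕ} (hi : (x i : Z) ∈ O) : ∃ j > i, (x j : Z) ∈ O := by
  obtain ⟨N, hN⟩ := (hb (x i)).mem_iff.1 ((hO.preimage continuous_subtype_val).mem_nhds hi)
  refine ⟨Nat.pair i (max N i) + 1, ?_, ?_⟩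
  · exact Nat.lt_succ_of_le (Nat.left_le_pair i _)
  · have h1 := h.mem_base (Nat.pair i (max N i))
    rw [Nat.unpair_pair] at h1
    exact hN ((hb (x i)).antitone ((le_max_left N i).trans (Nat.right_le_pair i _)) h1)

theorem not_isGδ_preimage (h : IsLimitTree F f b x P t A V) (hZ : CompletelyBaire Z)
    (hb : ∀ y, (𝓝 y).HasAntitoneBasis (b y)) (hF : ∀ s, IsClosed (F s))
    (hX : X = souslinOperation F) : ¬ IsGδ (f ⁻¹' ⋃ n, A n) := by
  intro hG
  obtain ⟨G, hGo, hGA⟩ := isGδ_iff_eq_iInter_nat.1 hG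
  choose O hO hOG using fun n => isOpen_induced_iff.1 (hGo n)
  let K : Set Z := closure (range fun j => (x j : Z))
  have hK : BaireSpace K := hZ K isClosed_closure
  have hxK : ∀ j, (x j : Z) ∈ K := fun j => subset_closure (mem_range_self j)
  have hdense : ∀ W : Set K, IsOpen W → W.Nonempty → ∃ j, (⟨x j, hxK j⟩ : K) ∈ W := by
    rintro W hW ⟨⟨z, hz⟩, hzW⟩
    obtain ⟨O', hO', rfl⟩ := isOpen_induced_iff.1 hW
    obtain ⟨_, hj, j, rfl⟩ := mem_closure_iff.1 hz O' hO' hzW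
    exact ⟨j, hj⟩
  have hO_dense : ∀ n, Dense ((↑) ⁻¹' O n : Set K) := fun n =>
    dense_iff_inter_open.2 fun W hW hne => by
      obtain ⟨j, hj⟩ := hdense W hW hne
      refine ⟨_, hj, ?_⟩
      have h1 : x j ∈ f ⁻¹' ⋃ n, A n := mem_iUnion.2 ⟨j, h.mem_image j⟩
      rw [hGA] at h1
      have h2 := mem_iInter.1 h1 n
      rwa [← hOG n] at h2
  -- `H i` collects the limits that stay with `x i` forever. The only tree point it can contain is
  -- `x i`, which other tree points approach, so it is nowhere dense in `K`.
  let H : ℕ → Set K := fun i => (↑) ⁻¹' ⋂ n ≥ i, closure (V n i)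
  have hH : ∀ i, IsClosed (H i) := fun i =>
    (isClosed_biInter fun n _ => isClosed_closure).preimage continuous_subtype_val
  have hxH : ∀ i j, (⟨x j, hxK j⟩ : K) ∈ H i → j = i := fun i j hj =>
    h.eq_of_mem_closure (le_max_right i j) (le_max_left i j)
      (subset_closure (h.mem_nhd _ j (le_max_right i j)))
      (mem_iInter₂.1 hj (max i j) (le_max_left i j))
  have hH_dense : ∀ i, Dense (H i)ᶜ := fun i =>
    dense_iff_inter_open.2 fun W hW hne => by
      obtain ⟨j, hj⟩ := hdense W hW hne
      by_cases hji : j = i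
      · obtain ⟨O', hO', rfl⟩ := isOpen_induced_iff.1 hW
        obtain ⟨k, hk, hkO⟩ := h.exists_ne_mem hb hO' hj
        exact ⟨⟨x k, hxK k⟩, hkO, fun hkH => by have := hxH i k hkH; omega⟩
      · exact ⟨_, hj, fun hjH => hji (hxH i j hjH)⟩
  have hD := (dense_iInter_of_isOpen_nat (fun n => (hO n).preimage continuous_subtype_val)
    hO_dense).inter_of_Gδ (IsGδ.iInter_of_isOpen fun n => (hO n).preimage continuous_subtype_val)
    (IsGδ.iInter_of_isOpen fun i => (hH i).isOpen_compl)
    (dense_iInter_of_isOpen_nat (fun i => (hH i).isOpen_compl) hH_dense)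
  have : Nonempty K := ⟨⟨x 0, hxK 0⟩⟩
  obtain ⟨⟨z, hzK⟩, hzO, hzH⟩ := hD.nonempty
  obtain ⟨hzX, hzA⟩ := h.exists_mem_of_not_eventually hF hX hzK fun i => by
    simpa [H] using mem_iInter.1 hzH i
  have h1 : (⟨z, hzX⟩ : X) ∈ f ⁻¹' ⋃ n, A n := by
    rw [hGA]
    refine mem_iInter.2 fun n => ?_
    rw [← hOG n]
    exact mem_iInter.1 hzO n
  obtain ⟨n, hn⟩ := mem_iUnion.1 h1
  exact hzA n hn

end IsLimitTree

end Limit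

theorem theorem2 {Y Z : Type*} [TopologicalSpace Y] [TopologicalSpace Z]
    [T3Space Y] [T3Space Z] (hZ : CompletelyBaire Z)
    (X : Set Z) (hX : IsSouslinF X) (hpp : PerfectlyParacompact X)
    (hfc : FirstCountableTopology X) (f : X → Y) :
    Delta02Measurable f ↔ PiecewiseContinuous f := by
  refine ⟨fun hf => ?_, PiecewiseContinuous.delta02Measurable hpp.2⟩
  obtain ⟨F, hF, hXF⟩ := hX
  rw [← smallFor_univ_iff]
  by_contra hsmall
  have hc : ∀ C : Set Y, IsClosed C → IsSigma02 (f ⁻¹' C) := fun C hC => by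
    simpa using (hf Cᶜ hC.isOpen_compl).2.isSigma02_compl
  choose b hb using fun y : X => (𝓝 y).exists_antitone_basis
  obtain ⟨x, P, t, A, V, h⟩ := exists_isLimitTree hpp (fun U hU => (hf U hU).1) hc hXF hsmall
    fun y n => (hb y).mem n
  exact h.not_isGδ_preimage hZ hb hF hXF (hf _ (isOpen_iUnion h.isOpen_image)).2
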